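/- Let $\mathbb{D}=\{z\in\mathbb{C}:|z|<1\}$, $\mathbb{T}=\partial\mathbb{D}$, and let $\overline{\mathbb{C}}=\mathbb{C}\cup\{\infty\}$ be the extended plane. A one-parameter semigroup in $\mathbb{D}$ is a family $(\phi_t)_{t\ge 0}$ of holomorphic maps $\phi_t:\mathbb{D}\to\mathbb{D}$ such that $\phi_0=\mathrm{id}_{\mathbb{D}}$, $\phi_{t+s}=\phi_t\circ\phi_s$ for all $t,s\ge 0$, and $\phi_t(z)\to z$ as $t\to 0^+$ for every $z\in\mathbb{D}$. For $\sigma\in\mathbb{T}$, a function $f$ on $\mathbb{D}$ has the angular limit $\ell$ at $\sigma$, written $\angle\lim_{z\to\sigma}f(z)=\ell$, if for every $\alpha\in(0,\pi/2)$ one has $f(z)\to\ell$ as $z\to\sigma$ within the Stolz angle $\{z\in\mathbb{D}:|\arg(1-\bar\sigma z)|<\alpha,\ |1-\bar\sigma z|<(\cos\alpha)/2\}$. Let $(\phi_t)$ be a non-trivial (not all $\phi_t$ equal $\mathrm{id}_{\mathbb{D}}$) one-parameter semigroup in $\mathbb{D}$ with Denjoy–Wolff point $\tau=1$; that is, for every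 $t>0$ with $\phi_t\neq\mathrm{id}_{\mathbb{D}}$ one has $\angle\lim_{z\to 1}\phi_t(z)=1$, and the angular derivative $\angle\lim_{z\to 1}(\phi_t(z)-1)/(z-1)$ exists finitely and has modulus at most $1$. Let $h:\mathbb{D}\to\mathbb{C}$ be a Kœnigs function of $(\phi_t)$, i.e. a univalent holomorphic function satisfying $h(\phi_t(z))=h(z)+t$ for all $t\ge 0$ and $z\in\mathbb{D}$. Then for every $\sigma\in\mathbb{T}$ the angular limit $\angle\lim_{z\to\sigma}h(z)$ exists in $\overline{\mathbb{C}}$. Moreover, for every $\sigma\in\mathbb{T}\setminus\{1\}$, $$\limsup_{\mathbb{D}\ni z\to\sigma}\operatorname{Re}h(z)<+\infty.$$ -/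

import Mathlib

open Set Filter Topology

/-- The Stolz angle of half-opening `α ∈ (0, π/2)` with vertex at the point `σ` of the unit circle:
a circular sector contained in the open unit disk, symmetric about the radius ending at `σ`. -/
def stolzAngle (σ : ℂ) (α : ℝ) : Set ℂ :=
  {z | ‖z‖ < 1 ∧ |Complex.arg (1 - (starRingEnd ℂ) σ * z)| < α ∧
    ‖1 - (starRingEnd ℂ) σ * z‖ < Real.cos α / 2}

/-- `f` has the angular (nontangential) limit `l` at the point `σ` of the unit circle. -/
def HasAngularLimit {X : Type*} [TopologicalSpace X] (f : ℂ → X) (σ : ℂ) (l : X) : Prop :=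
  ∀ α : ℝ, 0 < α → α < Real.pi / 2 → Tendsto f (𝓝[stolzAngle σ α] σ) (𝓝 l)

/-- `(φ t)`, `t ≥ 0`, is a one-parameter semigroup of holomorphic self-maps of the unit disk.
Values of `φ t z` for `t < 0` or for `z` outside the disk play no role. -/
structure IsOneParameterSemigroup (φ : ℝ → ℂ → ℂ) : Prop where
  holomorphic : ∀ t : ℝ, 0 ≤ t → DifferentiableOn ℂ (φ t) (Metric.ball 0 1)
  mapsTo : ∀ t : ℝ, 0 ≤ t → MapsTo (φ t) (Metric.ball 0 1) (Metric.ball 0 1)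
  zero : ∀ z ∈ Metric.ball (0 : ℂ) 1, φ 0 z = z
  add : ∀ t s : ℝ, 0 ≤ t → 0 ≤ s → ∀ z ∈ Metric.ball (0 : ℂ) 1, φ (t + s) z = φ t (φ s z)
  continuous : ∀ z ∈ Metric.ball (0 : ℂ) 1, Tendsto (fun t => φ t z) (𝓝[>] 0) (𝓝 z)

/-- `τ` is the Denjoy–Wolff point of the holomorphic self-map `f` of the unit disk, `f ≠ id`: the
fixed point in the closed disk at which the derivative has modulus at most one. When `|τ| = 1`,
the value `f τ` and the derivative are understood as angular limits. -/
def IsMapDenjoyWolffPoint (f : ℂ → ℂ) (τ : ℂ) : Prop :=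
  (‖τ‖ < 1 ∧ f τ = τ ∧ ‖deriv f τ‖ ≤ 1) ∨
  (‖τ‖ = 1 ∧ HasAngularLimit f τ τ ∧
    ∃ d : ℂ, ‖d‖ ≤ 1 ∧ HasAngularLimit (fun z => (f z - τ) / (z - τ)) τ d)

/-- `τ` is the Denjoy–Wolff point of the (non-trivial) one-parameter semigroup `(φ t)`: the common
Denjoy–Wolff point of all elements `φ t`, `t > 0`, different from the identity of the disk. -/
def IsDenjoyWolffPoint (φ : ℝ → ℂ → ℂ) (τ : ℂ) : Prop :=
  (∃ t : ℝ, 0 < t ∧ ¬ EqOn (φ t) id (Metric.ball 0 1)) ∧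
  ∀ t : ℝ, 0 < t → ¬ EqOn (φ t) id (Metric.ball 0 1) → IsMapDenjoyWolffPoint (φ t) τ

/-- `h` is a Kœnigs function of the one-parameter semigroup `(φ t)` whose Denjoy–Wolff point lies
on the unit circle: a univalent holomorphic function in the unit disk satisfying the Abel
functional equation. (It is unique up to an additive constant; no normalization is imposed.) -/
structure IsKoenigsFunction (φ : ℝ → ℂ → ℂ) (h : ℂ → ℂ) : Prop where
  holomorphic : DifferentiableOn ℂ h (Metric.ball 0 1)
  univalent : InjOn h (Metric.ball 0 1)
  abel : ∀ t : ℝ, 0 ≤ t → ∀ z ∈ Metric.ball (0 : ℂ) 1, h (φ t z) = h z + (t : ℂ)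

/-! ### Schwarz, Harnack and Julia inequalities for functions with nonnegative real part. -/

section PositiveRealPart

open Metric ComplexConjugate

/-! The Cayley map `w = (1 + z) / (1 - z)` sends the disk to the right half-plane and the
Denjoy–Wolff point 1 to ∞; let `k` be `h` in this coordinate. By Julia's lemma (`julia_halfPlane`)
the transported semigroup never decreases `Re w`. By the Abel equation, the difference quotient of
`k` between `w` and its image at time `t` is `t` over their difference, a number with nonnegative
real part. Letting `t → 0` gives `Re k' ≥ 0` (`re_deriv_koenigs_comp_invCayley_nonneg`), and
everything else follows from this inequality.

It makes `Re k` nondecreasing along horizontal lines, which bounds `Re h` above near each `σ ≠ 1`.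

At a finite boundary point, moved to 0, either `Re k` is bounded below on the positive axis or it
tends to `-∞` there. In the first case `|x k''(x)| ≤ 2 Re k'(x)`, so the variation of `k - x k'` is
dominated by that of `2 Re k`; hence `k - x k'` and then `k` converge, and `x k' → 0`. In both cases
the deviation of `k` in a sector from its axial values is `O(|x k'(x)|)`, which extends the radial
limit to sectors (`exists_tendsto_onePoint_of_re_deriv_nonneg`).

At ∞, Harnack's inequality prevents `Re k'` from decaying faster than `1 / |w|` in a sector, so
`|k|` grows at least logarithmically, unless `Re k'(1) = 0` and `k` is affine
(`tendsto_cobounded_of_re_deriv_nonneg`). -/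

theorem normSq_add_conj_sub_normSq_sub (a b : ℂ) :
    ‖a + conj b‖ ^ 2 - ‖a - b‖ ^ 2 = 4 * a.re * b.re := by
  rw [Complex.sq_norm, Complex.sq_norm, Complex.normSq_apply, Complex.normSq_apply]
  simp
  ring

/-- Schwarz lemma for functions with nonnegative real part on a disk. -/
theorem schwarz_of_re_nonneg {p : ℂ → ℂ} {c w : ℂ} {R : ℝ}
    (hp : DifferentiableOn ℂ p (ball c R)) (hre : ∀ z ∈ ball c R, 0 ≤ (p z).re)
    (hw : w ∈ ball c R) :
    R * ‖p w - p c‖ ≤ ‖w - c‖ * ‖p w + conj (p c)‖ := by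
  have hR : 0 < R := pos_of_mem_ball hw
  have hc : c ∈ ball c R := mem_ball_self hR
  -- Replacing `p` by `p + ε` keeps the denominator of the Cayley quotient nonzero even where `Re p`
  -- vanishes.
  have key : ∀ ε : ℝ, 0 < ε → R * ‖p w - p c‖ ≤ ‖w - c‖ * ‖p w + conj (p c) + 2 * ε‖ := by
    intro ε hε
    have hle : ∀ z ∈ ball c R, ‖p z - p c‖ ≤ ‖p z + conj (p c) + 2 * ε‖ := by
      intro z hz
      have h1 := normSq_add_conj_sub_normSq_sub (p z + ε) (p c + ε)
      have h2 : 0 ≤ 4 * (p z + ε).re * (p c + ε).re := by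
        have := hre z hz
        have := hre c hc
        simp
        positivity
      have h3 : p z + ε + conj (p c + (ε : ℂ)) = p z + conj (p c) + 2 * ε := by
        simp
        ring
      have h4 : p z + ε - (p c + ε) = p z - p c := by ring
      rw [h3, h4] at h1
      exact le_of_sq_le_sq (by linarith) (norm_nonneg _)
    have hne : ∀ z ∈ ball c R, p z + conj (p c) + 2 * ε ≠ 0 := by
      intro z hz h0
      have h1 := congrArg Complex.re h0
      have := hre z hz
      have := hre c hc
      simp at h1
      linarith
    have hmaps : MapsTo (fun z => (p z - p c) / (p z + conj (p c) + 2 * ε)) (ball c R)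
        (closedBall ((fun z => (p z - p c) / (p z + conj (p c) + 2 * ε)) c) 1) := by
      intro z hz
      simp only [sub_self, zero_div, mem_closedBall, dist_zero_right, norm_div]
      exact div_le_one_of_le₀ (hle z hz) (norm_nonneg _)
    have h1 := Complex.dist_le_div_mul_dist_of_mapsTo_ball
      ((hp.sub_const _).div ((hp.add_const _).add_const _) hne) hmaps hw
    simp only [Pi.div_apply, sub_self, zero_div, dist_eq_norm] at h1
    rw [sub_zero, norm_div, div_mul_eq_mul_div, one_mul, div_le_div_iff₀ (norm_pos_iff.2 (hne w hw)) hR] at h1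
    linarith
  have hlim : Tendsto (fun ε : ℝ => ‖w - c‖ * ‖p w + conj (p c) + 2 * ε‖) (𝓝[>] 0)
      (𝓝 (‖w - c‖ * ‖p w + conj (p c) + 2 * (0 : ℝ)‖)) := by
    refine tendsto_nhdsWithin_of_tendsto_nhds (Continuous.tendsto ?_ 0)
    fun_prop
  have := ge_of_tendsto hlim (eventually_nhdsWithin_of_forall key)
  simpa using this

variable {p : ℂ → ℂ} {c w : ℂ} {R : ℝ}

theorem norm_sub_le_of_re_nonneg
    (hp : DifferentiableOn ℂ p (ball c R)) (hre : ∀ z ∈ ball c R, 0 ≤ (p z).re)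
    (hw : w ∈ ball c R) :
    (R - ‖w - c‖) * ‖p w - p c‖ ≤ 2 * ‖w - c‖ * (p c).re := by
  have h1 := schwarz_of_re_nonneg hp hre hw
  have hc : c ∈ ball c R := mem_ball_self (pos_of_mem_ball hw)
  have h2 : ‖p w + conj (p c)‖ ≤ ‖p w - p c‖ + 2 * (p c).re := by
    have : p w + conj (p c) = (p w - p c) + ((2 * (p c).re : ℝ) : ℂ) := by
      rw [← Complex.add_conj]
      ring
    rw [this]
    refine (norm_add_le _ _).trans ?_
    rw [Complex.norm_real, Real.norm_of_nonneg (by linarith [hre c hc])]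
  nlinarith [norm_nonneg (w - c)]

/-- Square the Schwarz inequality: since `‖w - c‖ ≤ R`, the imaginary parts can be dropped, leaving
an inequality between real parts. -/
theorem harnack_of_re_nonneg
    (hp : DifferentiableOn ℂ p (ball c R)) (hre : ∀ z ∈ ball c R, 0 ≤ (p z).re)
    (hw : w ∈ ball c R) :
    (R - ‖w - c‖) * (p c).re ≤ (R + ‖w - c‖) * (p w).re := by
  have h1 := schwarz_of_re_nonneg hp hre hw
  have hR : 0 < R := pos_of_mem_ball hw
  have hd : ‖w - c‖ < R := by simpa [dist_eq_norm] using hw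
  have hc := hre c (mem_ball_self hR)
  have hw' := hre w hw
  have h2 : (R * ‖p w - p c‖) ^ 2 ≤ (‖w - c‖ * ‖p w + conj (p c)‖) ^ 2 :=
    pow_le_pow_left₀ (by positivity) h1 2
  rw [mul_pow, mul_pow, Complex.sq_norm (p w - p c), Complex.sq_norm (p w + conj (p c)),
    Complex.normSq_apply, Complex.normSq_apply] at h2
  simp only [Complex.sub_re, Complex.sub_im, Complex.add_re, Complex.add_im, Complex.conj_re,
    Complex.conj_im, ← sub_eq_add_neg] at h2
  have h3 : ‖w - c‖ ^ 2 ≤ R ^ 2 := pow_le_pow_left₀ (norm_nonneg _) hd.le 2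
  have h4 : (R * ((p c).re - (p w).re)) ^ 2 ≤ (‖w - c‖ * ((p w).re + (p c).re)) ^ 2 := by
    nlinarith [mul_nonneg (sub_nonneg.2 h3) (mul_self_nonneg ((p w).im - (p c).im))]
  have h5 := abs_le_of_sq_le_sq h4 (by positivity)
  nlinarith [(abs_le.1 h5).2]

theorem norm_deriv_le_of_re_nonneg (hR : 0 < R)
    (hp : DifferentiableOn ℂ p (ball c R)) (hre : ∀ z ∈ ball c R, 0 ≤ (p z).re) :
    R * ‖deriv p c‖ ≤ 2 * (p c).re := by
  have hd : HasDerivAt p (deriv p c) c :=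
    (hp.differentiableAt (ball_mem_nhds c hR)).hasDerivAt
  have h1 := (hasDerivAt_iff_tendsto_slope.1 hd).norm
  have h2 : Tendsto (fun w => (R - ‖w - c‖) * ‖slope p c w‖) (𝓝[≠] c)
      (𝓝 ((R - ‖c - c‖) * ‖deriv p c‖)) := by
    refine Tendsto.mul (tendsto_nhdsWithin_of_tendsto_nhds (Continuous.tendsto ?_ c)) h1
    fun_prop
  simp only [sub_self, norm_zero, sub_zero] at h2
  refine le_of_tendsto h2 ?_
  filter_upwards [self_mem_nhdsWithin, mem_nhdsWithin_of_mem_nhds (ball_mem_nhds c hR)]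
    with w hne hw
  have h3 := norm_sub_le_of_re_nonneg hp hre hw
  have h4 : 0 < ‖w - c‖ := norm_pos_iff.2 (sub_ne_zero.2 hne)
  rw [slope_def_field, norm_div, ← mul_div_assoc, div_le_iff₀ h4]
  linarith

/-- The disk version with centre 0, after the Cayley map sending 0 to `A`. -/
theorem schwarz_halfPlane {q : ℂ → ℂ} (hq : DifferentiableOn ℂ q {w | 0 < w.re})
    (hre : ∀ w : ℂ, 0 < w.re → 0 ≤ (q w).re) {A : ℝ} (hA : 0 < A) {w : ℂ} (hw : 0 < w.re) :
    ‖w + A‖ * ‖q w - q A‖ ≤ ‖w - A‖ * ‖q w + conj (q A)‖ := by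
  have hne : ∀ z ∈ ball (0 : ℂ) 1, 1 - z ≠ 0 := by
    intro z hz h0
    rw [sub_eq_zero] at h0
    simp [← h0] at hz
  have hpos : ∀ z ∈ ball (0 : ℂ) 1, 0 < (A * ((1 + z) / (1 - z))).re := by
    intro z hz
    have h1 : 0 < Complex.normSq (1 - z) := Complex.normSq_pos.2 (hne z hz)
    have h2 : ‖z‖ < 1 := by simpa using hz
    have h3 : z.re ^ 2 + z.im ^ 2 < 1 := by
      have := Complex.sq_norm z
      rw [Complex.normSq_apply] at this
      nlinarith [norm_nonneg z]
    rw [Complex.re_ofReal_mul, Complex.div_re]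
    simp only [Complex.add_re, Complex.one_re, Complex.sub_re, Complex.add_im, Complex.one_im,
      Complex.sub_im]
    rw [← add_div]
    refine mul_pos hA (div_pos ?_ h1)
    nlinarith
  have hd : DifferentiableOn ℂ (fun z => q (A * ((1 + z) / (1 - z)))) (ball 0 1) := by
    refine hq.comp (f := fun z : ℂ => (A : ℂ) * ((1 + z) / (1 - z))) ?_ hpos
    refine DifferentiableOn.const_mul (DifferentiableOn.div ?_ ?_ hne) _ <;> fun_prop
  have hwA : w + A ≠ 0 := by
    intro h0
    have := congrArg Complex.re h0
    simp at this
    linarith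
  have hlt : ‖w - A‖ < ‖w + A‖ := by
    have := normSq_add_conj_sub_normSq_sub w A
    simp at this
    refine lt_of_pow_lt_pow_left₀ 2 (norm_nonneg _) ?_
    have := mul_pos hw hA
    linarith
  have hζ : (w - A) / (w + A) ∈ ball (0 : ℂ) 1 := by
    rw [mem_ball_zero_iff, norm_div, div_lt_one (norm_pos_iff.2 hwA)]
    exact hlt
  have h1 := schwarz_of_re_nonneg hd (fun z hz => hre _ (hpos z hz)) hζ
  have hA' : (A : ℂ) ≠ 0 := by exact_mod_cast hA.ne'
  have h2 : (A : ℂ) * ((1 + (w - A) / (w + A)) / (1 - (w - A) / (w + A))) = w := by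
    have : w + A - (w - A) ≠ 0 := by
      ring_nf
      simpa using hA'
    field_simp
    ring
  simp only [h2] at h1
  simp only [add_zero, sub_zero, div_one, mul_one, one_mul, norm_div] at h1
  rw [div_mul_eq_mul_div, le_div_iff₀ (norm_pos_iff.2 hwA)] at h1
  linarith

/-- Julia's lemma at infinity for self-maps of the right half-plane. -/
theorem julia_halfPlane {q : ℂ → ℂ} (hq : DifferentiableOn ℂ q {w | 0 < w.re})
    (hre : ∀ w : ℂ, 0 < w.re → 0 ≤ (q w).re) {d : ℂ} (hd : ‖d‖ ≤ 1)
    (hlim : Tendsto (fun A : ℝ => (1 + A : ℂ) / (1 + q A)) atTop (𝓝 d))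
    {w : ℂ} (hw : 0 < w.re) : w.re ≤ (q w).re := by
  have hinv : Tendsto (fun A : ℝ => ‖(1 + A : ℂ)‖⁻¹) atTop (𝓝 0) := by
    refine tendsto_inv_atTop_zero.comp ?_
    refine tendsto_atTop_mono (fun A => ?_) tendsto_id
    have := Complex.re_le_norm (1 + A : ℂ)
    simp at this
    simp only [id]
    linarith
  have hpos : ∀ A : ℝ, 0 < A → 0 < ‖1 + q A‖ := by
    intro A hA
    have h1 := hre A (by simpa using hA)
    have := Complex.re_le_norm (1 + q A)
    simp at this
    linarith
  have hApos : ∀ A : ℝ, 0 < A → ‖(1 + A : ℂ)‖ = 1 + A := by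
    intro A hA
    rw [← Complex.ofReal_one, ← Complex.ofReal_add, Complex.norm_real,
      Real.norm_of_nonneg (by linarith)]
  have hratio : Tendsto (fun A : ℝ => (1 + A) / ‖1 + q A‖) atTop (𝓝 ‖d‖) := by
    refine hlim.norm.congr' ?_
    filter_upwards [eventually_gt_atTop 0] with A hA
    rw [norm_div, hApos A hA]
  have hG : Tendsto (fun A : ℝ => ‖1 + q A‖⁻¹) atTop (𝓝 0) := by
    have := hratio.mul hinv
    rw [mul_zero] at this
    refine this.congr' ?_
    filter_upwards [eventually_gt_atTop 0] with A hA
    rw [hApos A hA]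
    field_simp
  have hAi : Tendsto (fun A : ℝ => (1 + A)⁻¹) atTop (𝓝 0) := by
    refine hinv.congr' ?_
    filter_upwards [eventually_gt_atTop 0] with A hA
    rw [hApos A hA]
  set K := ‖q w - 1‖ with hK
  -- Both sides come from the squared Schwarz inequality with base point `A`, divided by `(1 + A) ‖1
  -- + q A‖ ^ 2`. As `A → ∞` it becomes `Re w ≤ ‖d‖ Re (q w)`.
  have hl : Tendsto (fun A : ℝ => w.re * (1 - (1 + A)⁻¹) * (1 - K * ‖1 + q A‖⁻¹) ^ 2) atTop
      (𝓝 (w.re * (1 - 0) * (1 - K * 0) ^ 2)) :=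
    (tendsto_const_nhds.mul (tendsto_const_nhds.sub hAi)).mul
      ((tendsto_const_nhds.sub (tendsto_const_nhds.mul hG)).pow 2)
  have hr : Tendsto (fun A : ℝ => (1 + ‖w - 1‖ * (1 + A)⁻¹) ^ 2 * (q w).re *
      ((1 + A) / ‖1 + q A‖)) atTop (𝓝 ((1 + ‖w - 1‖ * 0) ^ 2 * (q w).re * ‖d‖)) :=
    (((tendsto_const_nhds.add (tendsto_const_nhds.mul hAi)).pow 2).mul
      tendsto_const_nhds).mul hratio
  have hle : w.re * (1 - 0) * (1 - K * 0) ^ 2 ≤ (1 + ‖w - 1‖ * 0) ^ 2 * (q w).re * ‖d‖ := by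
    refine le_of_tendsto_of_tendsto hl hr ?_
    have hsmall : ∀ᶠ A : ℝ in atTop, K * ‖1 + q A‖⁻¹ < 1 := by
      have h0 : Tendsto (fun A : ℝ => K * ‖1 + q A‖⁻¹) atTop (𝓝 (K * 0)) :=
        tendsto_const_nhds.mul hG
      rw [mul_zero] at h0
      exact h0.eventually_lt_const one_pos
    filter_upwards [eventually_gt_atTop 0, hsmall] with A hA hs
    have hGA := hpos A hA
    have hQre := hre A (by simpa using hA)
    have h1 := schwarz_halfPlane hq hre hA hw
    have h2 : (‖w + A‖ * ‖q w - q A‖) ^ 2 ≤ (‖w - A‖ * ‖q w + conj (q A)‖) ^ 2 :=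
      pow_le_pow_left₀ (by positivity) h1 2
    have h3 := normSq_add_conj_sub_normSq_sub w A
    have h4 := normSq_add_conj_sub_normSq_sub (q w) (q A)
    simp only [Complex.conj_ofReal, Complex.ofReal_re] at h3
    have h5 : A * w.re * ‖q w + conj (q A)‖ ^ 2 ≤ ‖w + A‖ ^ 2 * (q w).re * (q A).re := by
      rw [mul_pow, mul_pow] at h2
      have e1 : ‖q w - q A‖ ^ 2 = ‖q w + conj (q A)‖ ^ 2 - 4 * (q w).re * (q A).re := by linarith
      have e2 : ‖w - A‖ ^ 2 = ‖w + A‖ ^ 2 - 4 * w.re * A := by linarith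
      rw [e1, e2] at h2
      nlinarith
    have h6 : ‖1 + q A‖ - K ≤ ‖q w + conj (q A)‖ := by
      have e1 : ‖1 + q A‖ = ‖(q w + conj (q A)) - (q w - 1)‖ := by
        rw [← Complex.norm_conj]
        congr 1
        simp
        ring
      rw [e1]
      have := norm_sub_le (q w + conj (q A)) (q w - 1)
      linarith
    have h7 : (q A).re ≤ ‖1 + q A‖ := by
      have := Complex.re_le_norm (1 + q A)
      simp at this
      linarith
    have h8 : ‖w + A‖ ≤ (1 + A) + ‖w - 1‖ := by
      have : w + A = (1 + A) + (w - 1) := by ring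
      rw [this, ← hApos A hA]
      exact norm_add_le _ _
    have h9 : 0 ≤ ‖1 + q A‖ - K := by
      rw [← div_eq_mul_inv, div_lt_one hGA] at hs
      linarith
    have h10 : A * w.re * (‖1 + q A‖ - K) ^ 2 ≤
        ((1 + A) + ‖w - 1‖) ^ 2 * (q w).re * ‖1 + q A‖ := by
      calc A * w.re * (‖1 + q A‖ - K) ^ 2 ≤ A * w.re * ‖q w + conj (q A)‖ ^ 2 := by gcongr
        _ ≤ ‖w + A‖ ^ 2 * (q w).re * (q A).re := h5
        _ ≤ _ := by
          have := hre w hw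
          gcongr
    have hA1 : 0 < 1 + A := by linarith
    have e1 : w.re * (1 - (1 + A)⁻¹) * (1 - K * ‖1 + q A‖⁻¹) ^ 2 =
        (A * w.re * (‖1 + q A‖ - K) ^ 2) / ((1 + A) * ‖1 + q A‖ ^ 2) := by
      field_simp
      ring
    have e2 : (1 + ‖w - 1‖ * (1 + A)⁻¹) ^ 2 * (q w).re * ((1 + A) / ‖1 + q A‖) =
        (((1 + A) + ‖w - 1‖) ^ 2 * (q w).re * ‖1 + q A‖) / ((1 + A) * ‖1 + q A‖ ^ 2) := by
      field_simp
    rw [e1, e2]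
    gcongr
  simp only [sub_zero, mul_zero, mul_one, add_zero, one_pow, one_mul] at hle
  nlinarith [hre w hw, norm_nonneg d]

end PositiveRealPart

/-! ### One-variable convergence criteria at `0⁺`. -/

theorem norm_sub_le_sub_of_norm_deriv_le_deriv {f f' : ℝ → ℂ} {B B' : ℝ → ℝ} {a b : ℝ}
    (hab : a ≤ b) (hf : ∀ x ∈ Icc a b, HasDerivAt f (f' x) x)
    (hB : ∀ x ∈ Icc a b, HasDerivAt B (B' x) x) (bound : ∀ x ∈ Icc a b, ‖f' x‖ ≤ B' x) :
    ‖f b - f a‖ ≤ B b - B a := by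
  refine image_norm_le_of_norm_deriv_right_le_deriv_boundary' (f := fun x => f x - f a)
    (B := fun x => B x - B a) (f' := f') (B' := B') (a := a) (b := b) ?_ ?_ (by simp) ?_ ?_
    (fun x hx => bound x (Ico_subset_Icc_self hx)) (right_mem_Icc.2 hab)
  · exact fun x hx => ((hf x hx).sub_const _).continuousAt.continuousWithinAt
  · exact fun x hx => ((hf x (Ico_subset_Icc_self hx)).sub_const _).hasDerivWithinAt
  · exact fun x hx => ((hB x hx).sub_const _).continuousAt.continuousWithinAt
  · exact fun x hx => ((hB x (Ico_subset_Icc_self hx)).sub_const _).hasDerivWithinAt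

theorem exists_tendsto_of_norm_sub_le_sub {f : ℝ → ℂ} {U : ℝ → ℝ} {m C : ℝ} (hC : 0 < C)
    (hm : ∀ x, 0 < x → m ≤ U x) (hU : MonotoneOn U (Ioi 0))
    (hf : ∀ x y, 0 < x → x ≤ y → ‖f y - f x‖ ≤ C * (U y - U x)) :
    ∃ L, Tendsto f (𝓝[>] 0) (𝓝 L) := by
  have hlim := MonotoneOn.tendsto_nhdsGT (x := (0 : ℝ)) hU ⟨m, by
    rintro _ ⟨x, hx, rfl⟩
    exact hm x hx⟩
  have hbdd : ∀ x, 0 < x → sInf (U '' Ioi 0) ≤ U x := fun x hx =>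
    csInf_le ⟨m, by
      rintro _ ⟨x, hx, rfl⟩
      exact hm x hx⟩ ⟨x, hx, rfl⟩
  set ℓ := sInf (U '' Ioi 0)
  refine cauchy_map_iff_exists_tendsto.1 (Metric.cauchy_iff.2 ⟨inferInstance, fun ε hε => ?_⟩)
  have h1 : ∀ᶠ x in 𝓝[>] (0 : ℝ), U x < ℓ + ε / (2 * C) :=
    hlim.eventually_lt_const (lt_add_of_pos_right _ (by positivity))
  refine ⟨f '' {x | 0 < x ∧ U x < ℓ + ε / (2 * C)}, ?_, ?_⟩
  · refine image_mem_map ?_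
    filter_upwards [h1, self_mem_nhdsWithin] with x hx hx0 using ⟨hx0, hx⟩
  · have key : ∀ x y, 0 < x → x ≤ y → U y < ℓ + ε / (2 * C) → ‖f y - f x‖ < ε := by
      intro x y hx hxy hy
      have h2 := hf x y hx hxy
      have h3 := hbdd x hx
      have h4 : C * (U y - U x) < C * (ε / (2 * C)) := by
        gcongr
        linarith
      have h5 : C * (ε / (2 * C)) = ε / 2 := by field_simp
      linarith
    rintro _ ⟨x, ⟨hx, hxU⟩, rfl⟩ _ ⟨y, ⟨hy, hyU⟩, rfl⟩
    rcases le_total x y with hxy | hxy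
    · rw [dist_comm, dist_eq_norm]
      exact key x y hx hxy hyU
    · rw [dist_eq_norm]
      exact key y x hy hxy hxU

/-- If `f - x f'` converges at `0`, then so does `f`, to the same limit. -/
theorem tendsto_of_tendsto_sub_mul_deriv {f f' : ℝ → ℂ} {L : ℂ}
    (hf : ∀ x, 0 < x → HasDerivAt f (f' x) x)
    (hE : Tendsto (fun x : ℝ => f x - x * f' x) (𝓝[>] 0) (𝓝 L)) :
    Tendsto f (𝓝[>] 0) (𝓝 L) := by
  rw [Metric.tendsto_nhds]
  intro ε hε
  obtain ⟨δ, hδ, hδE⟩ : ∃ δ > 0, ∀ x ∈ Ioc 0 δ, ‖f x - x * f' x - L‖ ≤ ε / 2 := by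
    have h1 := Metric.tendsto_nhds.1 hE (ε / 2) (half_pos hε)
    obtain ⟨δ, hδ, h2⟩ := mem_nhdsGT_iff_exists_Ioc_subset.1 h1
    refine ⟨δ, hδ, fun x hx => ?_⟩
    have := h2 hx
    rw [mem_ofPred_eq, dist_eq_norm] at this
    exact this.le
  have hlim : Tendsto (fun x : ℝ => x * ‖(f δ - L) / δ‖) (𝓝[>] 0) (𝓝 (0 * ‖(f δ - L) / δ‖)) :=
    tendsto_nhdsWithin_of_tendsto_nhds (tendsto_id.mul tendsto_const_nhds)
  rw [zero_mul] at hlim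
  filter_upwards [hlim.eventually_lt_const (half_pos hε), Ioc_mem_nhdsGT hδ] with x hx hxδ
  have h0 : ∀ y ∈ Icc x δ, 0 < y := fun y hy => hxδ.1.trans_le hy.1
  -- The derivative of `(f - L) / y` is `-(f - y f' - L) / y ^ 2`, of norm at most `(ε / 2) / y ^
  -- 2`; integrating over `[x, δ]` and multiplying by `x` costs at most `ε / 2`.
  have h1 := norm_sub_le_sub_of_norm_deriv_le_deriv (f := fun y : ℝ => (f y - L) / y)
    (f' := fun y : ℝ => -((f y - y * f' y - L) / (y : ℂ) ^ 2)) (B := fun y => -(ε / 2 * y⁻¹))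
    (B' := fun y => ε / 2 / y ^ 2) hxδ.2 ?_ ?_ ?_
  · have hx0 := hxδ.1
    have e1 : f x - L = x * ((f δ - L) / δ - ((f δ - L) / δ - (f x - L) / x)) := by
      have : (x : ℂ) ≠ 0 := by exact_mod_cast hx0.ne'
      field_simp
      ring
    have h2 : ‖f x - L‖ ≤ x * (‖(f δ - L) / δ‖ + (ε / 2 * x⁻¹ - ε / 2 * δ⁻¹)) := by
      rw [e1, norm_mul, Complex.norm_real, Real.norm_of_nonneg hx0.le]
      gcongr
      refine (norm_sub_le _ _).trans ?_
      gcongr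
      linarith
    have h3 : x * (ε / 2 * x⁻¹) = ε / 2 := by field_simp
    have h4 : 0 ≤ x * (ε / 2 * δ⁻¹) := by positivity
    rw [dist_eq_norm]
    nlinarith
  · intro y hy
    have hy0 : (y : ℂ) ≠ 0 := by exact_mod_cast (h0 y hy).ne'
    have := ((hf y (h0 y hy)).sub_const L).div (HasDerivAt.ofReal_comp (hasDerivAt_id y)) hy0
    refine this.congr_deriv ?_
    simp only [id, Complex.ofReal_one, mul_one]
    ring
  · intro y hy
    have := ((hasDerivAt_inv (h0 y hy).ne').const_mul (ε / 2)).neg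
    refine this.congr_deriv ?_
    ring
  · intro y hy
    have hy0 := h0 y hy
    rw [norm_neg, norm_div, norm_pow, Complex.norm_real, Real.norm_of_nonneg hy0.le]
    gcongr
    exact hδE y ⟨hy0, hy.2⟩

/-! ### Boundary limits at a finite point when `Re k' ≥ 0`. -/

section HalfPlane

open Metric

theorem isOpen_rightHalfPlane : IsOpen {w : ℂ | 0 < w.re} :=
  isOpen_lt continuous_const Complex.continuous_re

theorem ball_ofReal_subset_rightHalfPlane (A : ℝ) : ball (A : ℂ) A ⊆ {w : ℂ | 0 < w.re} := by
  intro w hw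
  rw [mem_ball, dist_eq_norm] at hw
  have := (abs_le.1 (Complex.abs_re_le_norm (w - A))).1
  simp at this
  show 0 < w.re
  linarith

variable {k : ℂ → ℂ} (hk : DifferentiableOn ℂ k {w | 0 < w.re})
  (hp : ∀ w : ℂ, 0 < w.re → 0 ≤ (deriv k w).re)

include hk in
theorem hasDerivAt_of_rightHalfPlane {w : ℂ} (hw : 0 < w.re) : HasDerivAt k (deriv k w) w :=
  (hk.differentiableAt (isOpen_rightHalfPlane.mem_nhds hw)).hasDerivAt

include hk in
theorem hasDerivAt_comp_line (a e : ℂ) {s : ℝ} (h : 0 < (a + s * e).re) :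
    HasDerivAt (fun s : ℝ => k (a + s * e)) (deriv k (a + s * e) * e) s := by
  have h1 : HasDerivAt (fun s : ℝ => a + s * e) e s := by
    simpa using ((HasDerivAt.ofReal_comp (hasDerivAt_id s)).mul_const e).const_add a
  exact (hasDerivAt_of_rightHalfPlane hk h).comp s h1

include hk hp in
theorem monotoneOn_re_horizontal (b : ℝ) :
    MonotoneOn (fun x : ℝ => (k (b * Complex.I + x)).re) (Ioi 0) := by
  have hd : ∀ x ∈ Ioi (0 : ℝ), HasDerivAt (fun x : ℝ => (k (b * Complex.I + x)).re)
      (deriv k (b * Complex.I + x)).re x := by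
    intro x hx
    have hx' : 0 < ((b : ℂ) * Complex.I + (x : ℝ) * 1).re := by simpa using hx
    have := hasDerivAt_comp_line hk (b * Complex.I) 1 hx'
    simp only [mul_one] at this
    exact (Complex.reCLM.hasFDerivAt.comp_hasDerivAt x this)
  refine monotoneOn_of_hasDerivWithinAt_nonneg (convex_Ioi 0)
    (f' := fun x => (deriv k (b * Complex.I + x)).re)
    (fun x hx => (hd x hx).continuousAt.continuousWithinAt) ?_ ?_
  · intro x hx
    rw [interior_Ioi] at hx
    exact (hd x hx).hasDerivWithinAt
  · intro x hx
    rw [interior_Ioi] at hx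
    exact hp _ (by simpa using hx)

include hk in
theorem differentiableOn_deriv_rightHalfPlane : DifferentiableOn ℂ (deriv k) {w | 0 < w.re} :=
  hk.deriv isOpen_rightHalfPlane

include hk hp in
/-- In a Stolz sector, `k` differs from its value at the projected real point `(M ^ 2 + 1) Re w`
by at most a constant times `c |k' c|`. -/
theorem exists_norm_sub_le_mul_norm_deriv {M : ℝ} :
    ∃ C : ℝ, 0 ≤ C ∧ ∀ w : ℂ, 0 < w.re → ‖w‖ ≤ M * w.re →
      ‖k w - k ((M ^ 2 + 1) * w.re : ℝ)‖ ≤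
        C * ‖(((M ^ 2 + 1) * w.re : ℝ) : ℂ) * deriv k ((M ^ 2 + 1) * w.re : ℝ)‖ := by
  -- With `c = (M ^ 2 + 1) Re w`, the point `w` lies within `ρ c` of `c`, where `ρ < 1` depends only
  -- on `M`. On that smaller disk `k'` is comparable to `k' c`.
  obtain ⟨ρ, hρ0, hρ1, hρ⟩ : ∃ ρ : ℝ, 0 ≤ ρ ∧ ρ < 1 ∧ ρ ^ 2 = M ^ 2 / (M ^ 2 + 1) := by
    have h0 : 0 ≤ M ^ 2 / (M ^ 2 + 1) := by positivity
    refine ⟨√(M ^ 2 / (M ^ 2 + 1)), Real.sqrt_nonneg _, ?_, Real.sq_sqrt h0⟩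
    rw [Real.sqrt_lt' one_pos, one_pow, div_lt_one (by positivity)]
    linarith
  have h1ρ : 0 < 1 - ρ := by linarith
  refine ⟨(1 + 2 * ρ / (1 - ρ)), by positivity, fun w hw hM => ?_⟩
  set c : ℝ := (M ^ 2 + 1) * w.re with hc
  have hc0 : 0 < c := by positivity
  have hwc : ‖w - c‖ ≤ ρ * c := by
    refine le_of_sq_le_sq ?_ (by positivity)
    have h1 : ‖w - c‖ ^ 2 = ‖w‖ ^ 2 - 2 * c * w.re + c ^ 2 := by
      rw [Complex.sq_norm, Complex.sq_norm, Complex.normSq_apply, Complex.normSq_apply]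
      simp
      ring
    have h2 : ‖w‖ ^ 2 ≤ (M * w.re) ^ 2 := pow_le_pow_left₀ (norm_nonneg _) hM 2
    have h3 : (ρ * c) ^ 2 = M ^ 2 * (M ^ 2 + 1) * w.re ^ 2 := by
      rw [mul_pow, hρ, hc]
      field_simp
    rw [h1, h3, hc]
    nlinarith [sq_nonneg w.re]
  have hball : closedBall (c : ℂ) (ρ * c) ⊆ ball (c : ℂ) c :=
    closedBall_subset_ball (by nlinarith)
  have hsub := ball_ofReal_subset_rightHalfPlane c
  have hbound : ∀ z ∈ closedBall (c : ℂ) (ρ * c),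
      ‖deriv k z‖ ≤ (1 + 2 * ρ / (1 - ρ)) * ‖deriv k c‖ := by
    intro z hz
    have h1 := norm_sub_le_of_re_nonneg ((differentiableOn_deriv_rightHalfPlane hk).mono hsub)
      (fun z hz => hp z (hsub hz)) (hball hz)
    rw [mem_closedBall, dist_eq_norm] at hz
    have h2 : (c - ρ * c) * ‖deriv k z - deriv k c‖ ≤ 2 * (ρ * c) * ‖deriv k c‖ := by
      calc (c - ρ * c) * ‖deriv k z - deriv k c‖
          ≤ (c - ‖z - c‖) * ‖deriv k z - deriv k c‖ := by gcongr
        _ ≤ 2 * ‖z - c‖ * (deriv k c).re := h1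
        _ ≤ 2 * (ρ * c) * ‖deriv k c‖ := by
          gcongr
          · exact hp _ (by simpa using hc0)
          · exact Complex.re_le_norm _
    have h3 : ‖deriv k z - deriv k c‖ ≤ 2 * ρ / (1 - ρ) * ‖deriv k c‖ := by
      rw [div_mul_eq_mul_div, le_div_iff₀ h1ρ]
      refine le_of_mul_le_mul_left ?_ hc0
      linarith
    have h4 : deriv k z = (deriv k z - deriv k c) + deriv k c := by ring
    rw [h4]
    refine (norm_add_le _ _).trans ?_
    linarith
  have h5 := Convex.norm_image_sub_le_of_norm_deriv_le
    (fun z hz => (hasDerivAt_of_rightHalfPlane hk (hsub (hball hz))).differentiableAt) hbound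
    (convex_closedBall _ _) (mem_closedBall_self (by positivity))
    (show w ∈ closedBall (c : ℂ) (ρ * c) by rwa [mem_closedBall, dist_eq_norm])
  refine h5.trans ?_
  rw [norm_mul, Complex.norm_real, Real.norm_of_nonneg hc0.le, mul_assoc]
  refine mul_le_mul_of_nonneg_left ?_ (by positivity)
  rw [mul_comm]
  gcongr
  nlinarith

include hk hp in
-- The Schwarz estimate on the unit disk about 1: `x` is at distance `x` from its boundary.
theorem norm_mul_deriv_le_of_le_one {x : ℝ} (hx : 0 < x) (hx1 : x ≤ 1) :
    ‖(x : ℂ) * deriv k x‖ ≤ 3 * ‖deriv k 1‖ := by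
  have hsub := ball_ofReal_subset_rightHalfPlane 1
  rw [Complex.ofReal_one] at hsub
  have hn : ‖(x : ℂ) - 1‖ = 1 - x := by
    rw [← Complex.ofReal_one, ← Complex.ofReal_sub, Complex.norm_real, Real.norm_eq_abs,
      abs_of_nonpos (by linarith)]
    ring
  have h1 := norm_sub_le_of_re_nonneg ((differentiableOn_deriv_rightHalfPlane hk).mono hsub)
    (fun z hz => hp z (hsub hz)) (w := (x : ℂ)) (by
      rw [mem_ball, dist_eq_norm, hn]
      linarith)
  rw [hn] at h1
  have h2 : ‖deriv k x‖ ≤ ‖deriv k x - deriv k 1‖ + ‖deriv k 1‖ := by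
    simpa using norm_add_le (deriv k x - deriv k 1) (deriv k 1)
  have h3 := Complex.re_le_norm (deriv k 1)
  have h4 := hp 1 (by simp)
  rw [norm_mul, Complex.norm_real, Real.norm_of_nonneg hx.le]
  have h5 : 2 * (1 - x) * (deriv k 1).re ≤ 2 * ‖deriv k 1‖ := by nlinarith
  nlinarith [norm_nonneg (deriv k 1)]

include hk hp in
/-- If `Re k` is bounded below along the real axis, then `k` has a limit at `0` along the
real axis, and `x k'(x) → 0`. -/
theorem exists_tendsto_ofReal_of_re_bddBelow {m : ℝ} (hm : ∀ x : ℝ, 0 < x → m ≤ (k x).re) :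
    ∃ L : ℂ, Tendsto (fun x : ℝ => k x) (𝓝[>] 0) (𝓝 L) ∧
      Tendsto (fun x : ℝ => (x : ℂ) * deriv k x) (𝓝[>] 0) (𝓝 0) := by
  have hd : ∀ x : ℝ, 0 < x → HasDerivAt (fun x : ℝ => k x) (deriv k x) x := fun x hx =>
    (hasDerivAt_of_rightHalfPlane hk (by simpa using hx)).comp_ofReal
  have hd2 : ∀ x : ℝ, 0 < x →
      HasDerivAt (fun x : ℝ => deriv k x) (deriv (deriv k) x) x := fun x hx =>
    (hasDerivAt_of_rightHalfPlane (differentiableOn_deriv_rightHalfPlane hk)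
      (by simpa using hx)).comp_ofReal
  have hmono : MonotoneOn (fun x : ℝ => (k x).re) (Ioi 0) := by
    simpa using monotoneOn_re_horizontal hk hp 0
  obtain ⟨L, hL⟩ := exists_tendsto_of_norm_sub_le_sub
    (f := fun x : ℝ => k x - x * deriv k x) two_pos hm hmono (by
      intro x y hx hxy
      rw [mul_sub]
      have h0 : ∀ z ∈ Icc x y, 0 < z := fun z hz => hx.trans_le hz.1
      refine norm_sub_le_sub_of_norm_deriv_le_deriv (f := fun x : ℝ => k x - x * deriv k x)
        (f' := fun x : ℝ => -(x * deriv (deriv k) x))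
        (B := fun x : ℝ => 2 * (k x).re) (B' := fun x : ℝ => 2 * (deriv k x).re) hxy ?_ ?_ ?_
      · intro z hz
        have := (hd z (h0 z hz)).sub
          ((HasDerivAt.ofReal_comp (hasDerivAt_id z)).mul (hd2 z (h0 z hz)))
        refine this.congr_deriv ?_
        simp only [id, Complex.ofReal_one, one_mul]
        ring
      · intro z hz
        exact (Complex.reCLM.hasFDerivAt.comp_hasDerivAt z (hd z (h0 z hz))).const_mul 2
      · intro z hz
        -- The disk of radius `z` about `z` lies in the half-plane, so the derivative estimate for
        -- `k'` there gives `z ‖k'' z‖ ≤ 2 Re k' z`.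
        have hz0 := h0 z hz
        rw [norm_neg, norm_mul, Complex.norm_real, Real.norm_of_nonneg hz0.le]
        have hsub := ball_ofReal_subset_rightHalfPlane z
        exact norm_deriv_le_of_re_nonneg hz0
          ((differentiableOn_deriv_rightHalfPlane hk).mono hsub) fun w hw => hp w (hsub hw))
  have hkL := tendsto_of_tendsto_sub_mul_deriv hd hL
  refine ⟨L, hkL, ?_⟩
  have := hkL.sub hL
  simpa using this

include hk hp in
/-- A function whose derivative has nonnegative real part in the right half-plane has a
nontangential limit in the extended plane at the boundary point `0`. -/
theorem exists_tendsto_onePoint_of_re_deriv_nonneg :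
    ∃ l : OnePoint ℂ, ∀ M : ℝ,
      Tendsto (fun w => (k w : OnePoint ℂ)) (𝓝[{w | 0 < w.re ∧ ‖w‖ ≤ M * w.re}] 0) (𝓝 l) := by
  have hmono : MonotoneOn (fun x : ℝ => (k x).re) (Ioi 0) := by
    simpa using monotoneOn_re_horizontal hk hp 0
  have hc : ∀ M : ℝ, Tendsto (fun w : ℂ => (M ^ 2 + 1) * w.re)
      (𝓝[{w | 0 < w.re ∧ ‖w‖ ≤ M * w.re}] 0) (𝓝[>] 0) := by
    intro M
    refine tendsto_nhdsWithin_iff.2 ⟨?_, ?_⟩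
    · refine tendsto_nhdsWithin_of_tendsto_nhds ?_
      have : Continuous fun w : ℂ => (M ^ 2 + 1) * w.re := by fun_prop
      simpa using this.tendsto 0
    · filter_upwards [self_mem_nhdsWithin] with w hw
      have := hw.1
      show 0 < (M ^ 2 + 1) * w.re
      positivity
  by_cases hbdd : ∃ m : ℝ, ∀ x : ℝ, 0 < x → m ≤ (k x).re
  · obtain ⟨m, hm⟩ := hbdd
    obtain ⟨L, hL, hL0⟩ := exists_tendsto_ofReal_of_re_bddBelow hk hp hm
    refine ⟨L, fun M => ?_⟩
    obtain ⟨C, -, hC⟩ := exists_norm_sub_le_mul_norm_deriv hk hp (M := M)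
    refine OnePoint.continuous_coe.continuousAt.tendsto.comp ?_
    have h1 := hL.comp (hc M)
    have h2 := ((hL0.comp (hc M)).norm.const_mul C)
    rw [norm_zero, mul_zero] at h2
    have h3 : Tendsto (fun w : ℂ => k w - k ((M ^ 2 + 1) * w.re : ℝ))
        (𝓝[{w | 0 < w.re ∧ ‖w‖ ≤ M * w.re}] 0) (𝓝 0) := by
      refine squeeze_zero_norm' ?_ h2
      filter_upwards [self_mem_nhdsWithin] with w hw using hC w hw.1 hw.2
    simpa [Function.comp_def] using h3.add h1
  · push Not at hbdd
    have hbot : Tendsto (fun x : ℝ => (k x).re) (𝓝[>] 0) atBot := by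
      refine tendsto_atBot.2 fun b => ?_
      obtain ⟨x, hx, hxb⟩ := hbdd b
      filter_upwards [Ioc_mem_nhdsGT hx] with y hy
      exact (hmono hy.1 hx hy.2).trans hxb.le
    refine ⟨OnePoint.infty, fun M => ?_⟩
    obtain ⟨C, hC0, hC⟩ := exists_norm_sub_le_mul_norm_deriv hk hp (M := M)
    -- Since `x k'(x)` is bounded for `x ≤ 1`, `Re k w` exceeds its value at the axial point by at
    -- most a constant.
    have hre : Tendsto (fun w => (k w).re) (𝓝[{w | 0 < w.re ∧ ‖w‖ ≤ M * w.re}] 0) atBot := by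
      refine tendsto_atBot_mono' _ ?_
        (tendsto_atBot_add_const_right _ (C * (3 * ‖deriv k 1‖)) (hbot.comp (hc M)))
      have h1 : ∀ᶠ w in 𝓝[{w : ℂ | 0 < w.re ∧ ‖w‖ ≤ M * w.re}] 0, (M ^ 2 + 1) * w.re ∈ Ioc 0 1 :=
        (hc M).eventually (Ioc_mem_nhdsGT one_pos)
      filter_upwards [self_mem_nhdsWithin, h1] with w hw hw1
      have h2 := hC w hw.1 hw.2
      have h3 := norm_mul_deriv_le_of_le_one hk hp hw1.1 hw1.2
      have h4 := (Complex.re_le_norm _).trans (h2.trans (mul_le_mul_of_nonneg_left h3 hC0))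
      rw [Complex.sub_re] at h4
      simp only [Function.comp_apply]
      linarith
    refine OnePoint.tendsto_coe_infty.comp ?_
    rw [coclosedCompact_eq_cocompact, ← Metric.cobounded_eq_cocompact,
      ← tendsto_norm_atTop_iff_cobounded]
    refine tendsto_atTop_mono (fun w => ?_) (tendsto_neg_atBot_atTop.comp hre)
    exact (neg_le_abs _).trans (Complex.abs_re_le_norm _)

end HalfPlane

/-! ### Growth at infinity when `Re k' ≥ 0`. -/

section Infinity

open Metric Bornology ComplexConjugate

variable {k : ℂ → ℂ} (hk : DifferentiableOn ℂ k {w | 0 < w.re})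
  (hp : ∀ w : ℂ, 0 < w.re → 0 ≤ (deriv k w).re)

include hk hp in
theorem re_deriv_one_le_mul_re_deriv {M : ℝ} {w : ℂ} (hw : 1 ≤ w.re) (hM : ‖w‖ ≤ M * w.re) :
    (deriv k 1).re ≤ 8 * M ^ 3 * ‖w‖ * (deriv k w).re := by
  have hr : 1 ≤ ‖w‖ := hw.trans (Complex.re_le_norm w)
  have hM1 : 1 ≤ M := by
    have := Complex.re_le_norm w
    by_contra! h
    nlinarith
  -- The disk of radius `A` about `A` contains 1, at distance 1 from its boundary, and `w`, at
  -- distance at least `‖w‖ ^ 2 / (2 * A)`. The comparison of 1 with `w` passes through the centre.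
  set A : ℝ := M * ‖w‖ with hA
  have hA1 : 1 ≤ A := one_le_mul_of_one_le_of_one_le hM1 hr
  have hsub := ball_ofReal_subset_rightHalfPlane A
  have hd := (differentiableOn_deriv_rightHalfPlane hk).mono hsub
  have hre : ∀ z ∈ ball (A : ℂ) A, 0 ≤ (deriv k z).re := fun z hz => hp z (hsub hz)
  have huA : 0 ≤ (deriv k A).re := hp _ (by simpa using by linarith)
  have hn1 : ‖(1 : ℂ) - A‖ = A - 1 := by
    rw [← Complex.ofReal_one, ← Complex.ofReal_sub, Complex.norm_real, Real.norm_eq_abs,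
      abs_of_nonpos (by linarith)]
    ring
  have h1 : (deriv k 1).re ≤ 2 * A * (deriv k A).re := by
    have := norm_sub_le_of_re_nonneg hd hre (w := 1) (by
      rw [mem_ball, dist_eq_norm, hn1]
      linarith)
    rw [hn1] at this
    have h2 := Complex.re_le_norm (deriv k 1 - deriv k A)
    rw [Complex.sub_re] at h2
    nlinarith
  have hd2 : ‖w - A‖ ^ 2 ≤ A ^ 2 - ‖w‖ ^ 2 := by
    have e1 : ‖w - A‖ ^ 2 = ‖w‖ ^ 2 - 2 * A * w.re + A ^ 2 := by
      rw [Complex.sq_norm, Complex.sq_norm, Complex.normSq_apply, Complex.normSq_apply]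
      simp
      ring
    rw [e1, hA]
    nlinarith [norm_nonneg w]
  have hlt : ‖w - A‖ < A := lt_of_pow_lt_pow_left₀ 2 (by linarith) (by nlinarith)
  have h3 := harnack_of_re_nonneg hd hre (w := w) (by rwa [mem_ball, dist_eq_norm])
  have hw' : 0 ≤ (deriv k w).re := hp w (by linarith)
  have h4 : ‖w‖ ^ 2 ≤ 2 * A * (A - ‖w - A‖) := by nlinarith [norm_nonneg (w - A)]
  have h5 : ‖w‖ ^ 2 * (deriv k A).re ≤ ‖w‖ ^ 2 * (4 * M ^ 2 * (deriv k w).re) := by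
    calc ‖w‖ ^ 2 * (deriv k A).re ≤ 2 * A * (A - ‖w - A‖) * (deriv k A).re := by gcongr
      _ = 2 * A * ((A - ‖w - A‖) * (deriv k A).re) := by ring
      _ ≤ 2 * A * ((A + ‖w - A‖) * (deriv k w).re) := by gcongr
      _ ≤ 2 * A * ((A + A) * (deriv k w).re) := by gcongr
      _ = _ := by
        rw [hA]
        ring
  have h6 := le_of_mul_le_mul_left h5 (by positivity)
  calc (deriv k 1).re ≤ 2 * A * (deriv k A).re := h1
    _ ≤ 2 * A * (4 * M ^ 2 * (deriv k w).re) := by gcongr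
    _ = _ := by
      rw [hA]
      ring

include hk hp in
-- Integrate `Re k' ≥ a / (1 + s T)` along the segment from 1 to `w`, which stays in the sector by
-- convexity; pairing with `conj (w - 1)` isolates `Re k'`.
theorem log_le_norm_sub_one {M : ℝ} {w : ℂ} (hw : 1 ≤ w.re) (hM : ‖w‖ ≤ M * w.re) :
    (deriv k 1).re / (8 * M ^ 3) * Real.log (1 + ‖w - 1‖) ≤ ‖k w - k 1‖ := by
  rcases eq_or_ne w 1 with rfl | hne
  · simp
  have hM1 : 1 ≤ M := by
    have := Complex.re_le_norm w
    by_contra! h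
    nlinarith
  set T := ‖w - 1‖ with hT
  have hT0 : 0 < T := norm_pos_iff.2 (sub_ne_zero.2 hne)
  set a := (deriv k 1).re / (8 * M ^ 3) with ha
  have ha0 : 0 ≤ a := div_nonneg (hp 1 (by simp)) (by positivity)
  have hre : ∀ s ∈ Icc (0 : ℝ) 1, 1 ≤ (1 + s * (w - 1)).re := by
    intro s hs
    simp only [Complex.add_re, Complex.one_re, Complex.re_ofReal_mul, Complex.sub_re]
    nlinarith [hs.1]
  have hsec : ∀ s ∈ Icc (0 : ℝ) 1, ‖1 + s * (w - 1)‖ ≤ M * (1 + s * (w - 1)).re := by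
    intro s hs
    have e1 : 1 + s * (w - 1) = ((1 - s : ℝ) : ℂ) + s * w := by
      push_cast
      ring
    rw [e1]
    refine (norm_add_le _ _).trans ?_
    rw [norm_mul, Complex.norm_real, Complex.norm_real, Real.norm_of_nonneg hs.1,
      Real.norm_of_nonneg (sub_nonneg.2 hs.2), Complex.add_re, Complex.ofReal_re,
      Complex.re_ofReal_mul]
    nlinarith [hs.1, hs.2, mul_le_mul_of_nonneg_left hM hs.1]
  have hlog : ∀ s ∈ Icc (0 : ℝ) 1, 0 < 1 + s * T := fun s hs => by nlinarith [hs.1]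
  have key := norm_sub_le_sub_of_norm_deriv_le_deriv
    (f := fun s : ℝ => ((T * (a * Real.log (1 + s * T)) : ℝ) : ℂ))
    (f' := fun s : ℝ => ((T * (a * (T / (1 + s * T))) : ℝ) : ℂ))
    (B := fun s : ℝ => (conj (w - 1) * k (1 + s * (w - 1))).re)
    (B' := fun s : ℝ => (conj (w - 1) * (deriv k (1 + s * (w - 1)) * (w - 1))).re)
    (zero_le_one' ℝ) ?_ ?_ ?_
  · have h1 : ‖((T * (a * Real.log (1 + 1 * T)) : ℝ) : ℂ) -
        ((T * (a * Real.log (1 + 0 * T)) : ℝ) : ℂ)‖ = T * (a * Real.log (1 + T)) := by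
      have h0 : 0 ≤ Real.log (1 + T) := Real.log_nonneg (by linarith)
      rw [← Complex.ofReal_sub, Complex.norm_real]
      simp only [one_mul, zero_mul, add_zero, Real.log_one, mul_zero, sub_zero]
      exact Real.norm_of_nonneg (by positivity)
    rw [h1] at key
    have h2 : (conj (w - 1) * k (1 + (1 : ℝ) * (w - 1))).re -
        (conj (w - 1) * k (1 + (0 : ℝ) * (w - 1))).re ≤ T * ‖k w - k 1‖ := by
      rw [← Complex.sub_re, ← mul_sub, hT, ← Complex.norm_conj (w - 1), ← norm_mul]
      refine (Complex.re_le_norm _).trans_eq ?_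
      simp
    exact le_of_mul_le_mul_left (key.trans h2) hT0
  · intro s hs
    have h1 : HasDerivAt (fun s : ℝ => 1 + s * T) T s := by
      simpa using ((hasDerivAt_id s).mul_const T).const_add 1
    exact HasDerivAt.ofReal_comp (((h1.log (hlog s hs).ne').const_mul a).const_mul T)
  · intro s hs
    have h1 := hasDerivAt_comp_line hk 1 (w - 1) (s := s) (by linarith [hre s hs])
    exact Complex.reCLM.hasFDerivAt.comp_hasDerivAt s (h1.const_mul (conj (w - 1)))
  · intro s hs
    have h0 := hlog s hs
    have h1 := re_deriv_one_le_mul_re_deriv hk hp (hre s hs) (hsec s hs)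
    have h2 : ‖1 + s * (w - 1)‖ ≤ 1 + s * T := by
      refine (norm_add_le _ _).trans ?_
      rw [norm_mul, Complex.norm_real, Real.norm_of_nonneg hs.1, norm_one]
    have hu := hp (1 + s * (w - 1)) (by linarith [hre s hs])
    set u := (deriv k (1 + s * (w - 1))).re with hu'
    have e1 : (conj (w - 1) * (deriv k (1 + s * (w - 1)) * (w - 1))).re = T * (T * u) := by
      have : conj (w - 1) * (deriv k (1 + s * (w - 1)) * (w - 1)) =
          ((T ^ 2 : ℝ) : ℂ) * deriv k (1 + s * (w - 1)) := by
        rw [hT, Complex.ofReal_pow, ← Complex.conj_mul']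
        ring
      rw [this, Complex.re_ofReal_mul]
      ring
    rw [e1, Complex.norm_real, Real.norm_of_nonneg (by positivity)]
    have h3 : a ≤ (1 + s * T) * u := by
      rw [ha, div_le_iff₀ (by positivity)]
      calc (deriv k 1).re ≤ 8 * M ^ 3 * ‖1 + s * (w - 1)‖ * u := h1
        _ ≤ 8 * M ^ 3 * (1 + s * T) * u := by gcongr
        _ = _ := by ring
    have h4 : a * (T / (1 + s * T)) ≤ T * u := by
      rw [← mul_div_assoc, div_le_iff₀ h0]
      nlinarith
    gcongr

include hk hp in
-- Here `Re k'` attains its minimum 0 at an interior point, so `k'` is constant: in the Schwarz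
-- inequality both sides carry the factor `‖k' z - k' 1‖`, while `‖z - 1‖ < ‖z + 1‖`.
theorem eq_add_mul_of_re_deriv_one_eq_zero (h0 : (deriv k 1).re = 0) {w : ℂ} (hw : 0 < w.re) :
    k w - k 1 = deriv k 1 * (w - 1) := by
  have hconst : ∀ z : ℂ, 0 < z.re → deriv k z = deriv k 1 := by
    intro z hz
    have h1 := schwarz_halfPlane (differentiableOn_deriv_rightHalfPlane hk) hp one_pos hz
    have h2 : conj (deriv k 1) = -deriv k 1 := by
      apply Complex.ext <;> simp [h0]
    rw [Complex.ofReal_one, h2, ← sub_eq_add_neg] at h1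
    have h3 := normSq_add_conj_sub_normSq_sub z 1
    simp only [map_one, Complex.one_re, mul_one] at h3
    have h4 : ‖z - 1‖ < ‖z + 1‖ := lt_of_pow_lt_pow_left₀ 2 (norm_nonneg _) (by linarith)
    have h5 : ‖deriv k z - deriv k 1‖ = 0 := by
      by_contra hne
      have : 0 < ‖deriv k z - deriv k 1‖ := lt_of_le_of_ne (norm_nonneg _) (Ne.symm hne)
      nlinarith
    exact sub_eq_zero.1 (norm_eq_zero.1 h5)
  have h1 := Convex.norm_image_sub_le_of_norm_hasDerivWithin_le
    (f := fun z => k z - deriv k 1 * z) (f' := fun _ => 0) (C := 0) (s := {w : ℂ | 0 < w.re})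
    (x := 1) (y := w) (fun z hz => ?_) (by simp) (convex_halfSpace_re_gt 0) (by simp) hw
  · rw [zero_mul, norm_le_zero_iff] at h1
    linear_combination h1
  · have h2 := (hasDerivAt_of_rightHalfPlane hk hz).sub ((hasDerivAt_id z).const_mul (deriv k 1))
    refine (h2.congr_deriv ?_).hasDerivWithinAt
    rw [hconst z hz]
    ring

include hk hp in
theorem tendsto_cobounded_of_re_deriv_nonneg (hne : deriv k 1 ≠ 0) (M : ℝ) :
    Tendsto k (cobounded ℂ ⊓ 𝓟 {w | 0 < w.re ∧ ‖w‖ ≤ M * w.re}) (cobounded ℂ) := by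
  have hn : Tendsto (fun w : ℂ => ‖w‖) (cobounded ℂ ⊓ 𝓟 {w | 0 < w.re ∧ ‖w‖ ≤ M * w.re}) atTop :=
    tendsto_norm_cobounded_atTop.mono_left inf_le_left
  have hmem : ∀ᶠ w in cobounded ℂ ⊓ 𝓟 {w : ℂ | 0 < w.re ∧ ‖w‖ ≤ M * w.re},
      0 < w.re ∧ ‖w‖ ≤ M * w.re := eventually_inf_principal.2 (Eventually.of_forall fun _ h => h)
  have hT : Tendsto (fun w : ℂ => ‖w - 1‖)
      (cobounded ℂ ⊓ 𝓟 {w | 0 < w.re ∧ ‖w‖ ≤ M * w.re}) atTop := by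
    refine tendsto_atTop_mono (fun w => ?_) (tendsto_atTop_add_const_right _ (-1) hn)
    have := norm_sub_norm_le w 1
    rw [norm_one] at this
    linarith
  suffices h : Tendsto (fun w => ‖k w - k 1‖)
      (cobounded ℂ ⊓ 𝓟 {w | 0 < w.re ∧ ‖w‖ ≤ M * w.re}) atTop by
    rw [← tendsto_norm_atTop_iff_cobounded]
    refine tendsto_atTop_mono (fun w => ?_) (tendsto_atTop_add_const_right _ (-‖k 1‖) h)
    have := norm_sub_le (k w) (k 1)
    linarith
  have hp1 : 0 ≤ (deriv k 1).re := hp 1 (by simp)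
  rcases hp1.eq_or_lt with h0 | h0
  · have h1 : Tendsto (fun w : ℂ => ‖deriv k 1‖ * ‖w - 1‖)
        (cobounded ℂ ⊓ 𝓟 {w | 0 < w.re ∧ ‖w‖ ≤ M * w.re}) atTop :=
      hT.const_mul_atTop (norm_pos_iff.2 hne)
    refine h1.congr' ?_
    filter_upwards [hmem] with w hw
    rw [eq_add_mul_of_re_deriv_one_eq_zero hk hp h0.symm hw.1, norm_mul]
  · rcases le_or_gt M 0 with hM | hM
    · have hbot : cobounded ℂ ⊓ 𝓟 {w : ℂ | 0 < w.re ∧ ‖w‖ ≤ M * w.re} = ⊥ := by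
        have : {w : ℂ | 0 < w.re ∧ ‖w‖ ≤ M * w.re} = ∅ := by
          refine eq_empty_of_forall_notMem fun w hw => ?_
          have h1 := hw.2
          have h2 := Complex.re_le_norm w
          nlinarith [hw.1]
        rw [this, principal_empty, inf_bot_eq]
      rw [hbot]
      exact tendsto_bot
    have h1 : Tendsto (fun w : ℂ => (deriv k 1).re / (8 * M ^ 3) * Real.log (1 + ‖w - 1‖))
        (cobounded ℂ ⊓ 𝓟 {w | 0 < w.re ∧ ‖w‖ ≤ M * w.re}) atTop :=
      (Real.tendsto_log_atTop.comp (tendsto_atTop_add_const_left _ 1 hT)).const_mul_atTop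
        (by positivity)
    refine tendsto_atTop_mono' _ ?_ h1
    filter_upwards [hmem, hn.eventually_ge_atTop M] with w hw hwM
    have : M * 1 ≤ M * w.re := by linarith [hw.2]
    exact log_le_norm_sub_one hk hp (le_of_mul_le_mul_left this hM) hw.2

end Infinity

/-! ### The Cayley transform and Stolz angles. -/

section Cayley

open Metric Bornology ComplexConjugate

theorem cayley_re (z : ℂ) : ((1 + z) / (1 - z)).re = (1 - ‖z‖ ^ 2) / ‖1 - z‖ ^ 2 := by
  rw [Complex.div_re, Complex.sq_norm, Complex.sq_norm, Complex.normSq_apply z, ← add_div]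
  simp
  ring

theorem one_sub_ne_zero_of_mem_ball {z : ℂ} (hz : z ∈ ball (0 : ℂ) 1) : 1 - z ≠ 0 := by
  intro h0
  rw [sub_eq_zero] at h0
  simp [← h0] at hz

theorem cayley_re_pos {z : ℂ} (hz : z ∈ ball (0 : ℂ) 1) : 0 < ((1 + z) / (1 - z)).re := by
  rw [cayley_re]
  have h1 : ‖z‖ < 1 := by simpa using hz
  have h2 : 0 < ‖1 - z‖ := norm_pos_iff.2 (one_sub_ne_zero_of_mem_ball hz)
  have h3 : 0 < 1 - ‖z‖ ^ 2 := by nlinarith [norm_nonneg z]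
  positivity

theorem add_one_ne_zero_of_re_pos {w : ℂ} (hw : 0 < w.re) : w + 1 ≠ 0 := by
  intro h0
  have := congrArg Complex.re h0
  simp at this
  linarith

theorem invCayley_mem_ball {w : ℂ} (hw : 0 < w.re) : (w - 1) / (w + 1) ∈ ball (0 : ℂ) 1 := by
  rw [mem_ball_zero_iff, norm_div, div_lt_one (norm_pos_iff.2 (add_one_ne_zero_of_re_pos hw))]
  have h3 := normSq_add_conj_sub_normSq_sub w 1
  simp only [map_one, Complex.one_re, mul_one] at h3
  exact lt_of_pow_lt_pow_left₀ 2 (norm_nonneg _) (by linarith)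

theorem cayley_invCayley {w : ℂ} (hw : 0 < w.re) :
    (1 + (w - 1) / (w + 1)) / (1 - (w - 1) / (w + 1)) = w := by
  have h1 := add_one_ne_zero_of_re_pos hw
  have h2 : w + 1 - (w - 1) ≠ 0 := by
    ring_nf
    norm_num
  field_simp
  ring

theorem invCayley_cayley {z : ℂ} (hz : 1 - z ≠ 0) :
    ((1 + z) / (1 - z) - 1) / ((1 + z) / (1 - z) + 1) = z := by
  have h2 : 1 + z + (1 - z) ≠ 0 := by
    ring_nf
    norm_num
  field_simp
  ring

/-- With `ζ = 1 - conj σ * z`, `1 - ‖z‖ ^ 2 = 2 Re ζ - ‖ζ‖ ^ 2`. The angle gives `Re ζ ≥ cos α ‖ζ‖`,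
and the radius `cos α / 2` absorbs the square. -/
theorem cos_mul_norm_sub_le_of_mem_stolzAngle {σ z : ℂ} {α : ℝ} (hσ : ‖σ‖ = 1)
    (hα : α < Real.pi / 2) (hz : z ∈ stolzAngle σ α) :
    Real.cos α * ‖z - σ‖ ≤ 1 - ‖z‖ ^ 2 := by
  obtain ⟨hz1, harg, hn⟩ := hz
  set ζ := 1 - conj σ * z with hζ
  have hα0 : 0 < α := (abs_nonneg _).trans_lt harg
  have h1 : ‖z - σ‖ = ‖ζ‖ := by
    have e1 : ζ = -(conj σ * (z - σ)) := by
      rw [mul_sub, Complex.conj_mul', hσ, hζ]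
      simp
    rw [e1, norm_neg, norm_mul, Complex.norm_conj, hσ, one_mul]
  have h2 : ‖z‖ ^ 2 = 1 - 2 * ζ.re + ‖ζ‖ ^ 2 := by
    have e1 : ‖z‖ = ‖1 - ζ‖ := by
      rw [hζ, sub_sub_cancel, norm_mul, Complex.norm_conj, hσ, one_mul]
    rw [e1, Complex.sq_norm, Complex.sq_norm, Complex.normSq_apply, Complex.normSq_apply]
    simp
    ring
  have h3 : Real.cos α ≤ Real.cos (Complex.arg ζ) := by
    rw [← Real.cos_abs (Complex.arg ζ)]
    exact Real.cos_le_cos_of_nonneg_of_le_pi (abs_nonneg _) (by linarith [Real.pi_pos]) harg.le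
  have h4 : ‖ζ‖ * Real.cos α ≤ ζ.re := by
    rw [← Complex.norm_mul_cos_arg ζ]
    gcongr
  have h5 : 0 < Real.cos α := Real.cos_pos_of_mem_Ioo ⟨by linarith, hα⟩
  rw [h1, h2]
  nlinarith [norm_nonneg ζ]

theorem cayley_sub_cayley {z σ : ℂ} (hz : 1 - z ≠ 0) (hσ : 1 - σ ≠ 0) :
    (1 + z) / (1 - z) - (1 + σ) / (1 - σ) = 2 * (z - σ) / ((1 - z) * (1 - σ)) := by
  field_simp
  ring

theorem continuousAt_cayley {σ : ℂ} (hσ : σ ≠ 1) :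
    ContinuousAt (fun z : ℂ => (1 + z) / (1 - z)) σ :=
  ContinuousAt.div (by fun_prop) (by fun_prop) (sub_ne_zero.2 hσ.symm)

theorem tendsto_cayley_stolzAngle {σ : ℂ} {α : ℝ} (hσ : ‖σ‖ = 1) (hσ1 : σ ≠ 1) (hα0 : 0 < α)
    (hα : α < Real.pi / 2) :
    ∃ M : ℝ, Tendsto (fun z : ℂ => (1 + z) / (1 - z) - (1 + σ) / (1 - σ)) (𝓝[stolzAngle σ α] σ)
      (𝓝[{w | 0 < w.re ∧ ‖w‖ ≤ M * w.re}] 0) := by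
  have hc : 0 < Real.cos α := Real.cos_pos_of_mem_Ioo ⟨by linarith, hα⟩
  have hσ' : 1 - σ ≠ 0 := sub_ne_zero.2 hσ1.symm
  have hσn : 0 < ‖1 - σ‖ := norm_pos_iff.2 hσ'
  -- The ratio of modulus to real part is `2 ‖z - σ‖ ‖1 - z‖ / ((1 - ‖z‖ ^ 2) ‖1 - σ‖)`; the Stolz
  -- estimate and `‖1 - z‖ ≤ 2` bound it by this constant.
  refine ⟨4 / (Real.cos α * ‖1 - σ‖), tendsto_nhdsWithin_iff.2 ⟨?_, ?_⟩⟩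
  · refine tendsto_nhdsWithin_of_tendsto_nhds ?_
    have := (continuousAt_cayley hσ1).tendsto.sub_const ((1 + σ) / (1 - σ))
    rwa [sub_self] at this
  · filter_upwards [self_mem_nhdsWithin] with z hz
    have hzb : z ∈ ball (0 : ℂ) 1 := by simpa using hz.1
    have hz1 := one_sub_ne_zero_of_mem_ball hzb
    have hzn : 0 < ‖1 - z‖ := norm_pos_iff.2 hz1
    have hre : ((1 + z) / (1 - z) - (1 + σ) / (1 - σ)).re = (1 - ‖z‖ ^ 2) / ‖1 - z‖ ^ 2 := by
      rw [Complex.sub_re, cayley_re, cayley_re, hσ]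
      simp
    refine ⟨?_, ?_⟩
    · rw [hre, ← cayley_re]
      exact cayley_re_pos hzb
    · rw [hre, cayley_sub_cayley hz1 hσ', norm_div, norm_mul, norm_mul, Complex.norm_two]
      have h1 := cos_mul_norm_sub_le_of_mem_stolzAngle hσ hα hz
      have h2 : ‖1 - z‖ ≤ 2 := by
        refine (norm_sub_le _ _).trans ?_
        rw [norm_one]
        linarith [hz.1]
      have h3 : 0 ≤ 1 - ‖z‖ ^ 2 := le_trans (by positivity) h1
      have e1 : 4 / (Real.cos α * ‖1 - σ‖) * ((1 - ‖z‖ ^ 2) / ‖1 - z‖ ^ 2) =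
          (2 * (2 * (1 - ‖z‖ ^ 2))) / (‖1 - z‖ * ‖1 - σ‖) / (Real.cos α * ‖1 - z‖) := by
        field_simp
        ring
      rw [e1, le_div_iff₀ (by positivity), div_mul_eq_mul_div]
      refine div_le_div_of_nonneg_right ?_ (by positivity)
      nlinarith [mul_le_mul_of_nonneg_right h1 hzn.le, mul_le_mul_of_nonneg_left h2 h3]

theorem tendsto_cayley_stolzAngle_one {α : ℝ} (hα0 : 0 < α) (hα : α < Real.pi / 2) :
    ∃ M : ℝ, Tendsto (fun z : ℂ => (1 + z) / (1 - z)) (𝓝[stolzAngle 1 α] 1)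
      (cobounded ℂ ⊓ 𝓟 {w | 0 < w.re ∧ ‖w‖ ≤ M * w.re}) := by
  have hc : 0 < Real.cos α := Real.cos_pos_of_mem_Ioo ⟨by linarith, hα⟩
  have hre : ∀ z ∈ stolzAngle 1 α, Real.cos α * ‖1 - z‖⁻¹ ≤ ((1 + z) / (1 - z)).re := by
    intro z hz
    have h1 := cos_mul_norm_sub_le_of_mem_stolzAngle norm_one hα hz
    have hzb : z ∈ ball (0 : ℂ) 1 := by simpa using hz.1
    have hzn : 0 < ‖1 - z‖ := norm_pos_iff.2 (one_sub_ne_zero_of_mem_ball hzb)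
    rw [norm_sub_rev] at h1
    rw [cayley_re, le_div_iff₀ (by positivity)]
    have e1 : Real.cos α * ‖1 - z‖⁻¹ * ‖1 - z‖ ^ 2 = Real.cos α * ‖1 - z‖ := by field_simp
    rwa [e1]
  refine ⟨2 / Real.cos α, tendsto_inf.2 ⟨?_, tendsto_principal.2 ?_⟩⟩
  · rw [← tendsto_norm_atTop_iff_cobounded]
    have h0 : Tendsto (fun z : ℂ => ‖1 - z‖) (𝓝[stolzAngle 1 α] 1) (𝓝[>] 0) := by
      refine tendsto_nhdsWithin_iff.2 ⟨tendsto_nhdsWithin_of_tendsto_nhds ?_, ?_⟩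
      · have : Continuous fun z : ℂ => ‖1 - z‖ := by fun_prop
        simpa using this.tendsto 1
      · filter_upwards [self_mem_nhdsWithin] with z hz
        exact norm_pos_iff.2 (one_sub_ne_zero_of_mem_ball (by simpa using hz.1))
    refine tendsto_atTop_mono' _ ?_ ((tendsto_inv_nhdsGT_zero.comp h0).const_mul_atTop hc)
    filter_upwards [self_mem_nhdsWithin] with z hz
    exact (hre z hz).trans (Complex.re_le_norm _)
  · filter_upwards [self_mem_nhdsWithin] with z hz
    have hzb : z ∈ ball (0 : ℂ) 1 := by simpa using hz.1
    have hzn : 0 < ‖1 - z‖ := norm_pos_iff.2 (one_sub_ne_zero_of_mem_ball hzb)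
    refine ⟨cayley_re_pos hzb, ?_⟩
    calc ‖(1 + z) / (1 - z)‖ ≤ 2 * ‖1 - z‖⁻¹ := by
          rw [norm_div, div_eq_mul_inv]
          gcongr
          refine (norm_add_le _ _).trans ?_
          rw [norm_one]
          linarith [hz.1]
      _ = 2 / Real.cos α * (Real.cos α * ‖1 - z‖⁻¹) := by field_simp
      _ ≤ _ := by
        gcongr
        exact hre z hz

/-- Large real `A` correspond to the radius ending at 1, so the angular derivative can be read off
along `A → ∞`; the opening `π / 4` is arbitrary. -/
theorem tendsto_invCayley_stolzAngle :
    Tendsto (fun A : ℝ => ((A : ℂ) - 1) / (A + 1)) atTop (𝓝[stolzAngle 1 (Real.pi / 4)] 1) := by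
  have e : ∀ A : ℝ, 0 < A → 1 - ((A : ℂ) - 1) / (A + 1) = ((2 / (A + 1) : ℝ) : ℂ) := by
    intro A hA
    have : (A : ℂ) + 1 ≠ 0 := add_one_ne_zero_of_re_pos (by simpa using hA)
    push_cast
    field_simp
    ring
  have hlim : Tendsto (fun A : ℝ => 2 / (A + 1)) atTop (𝓝 0) :=
    tendsto_const_nhds.div_atTop (tendsto_atTop_add_const_right _ _ tendsto_id)
  have hcos : 0 < Real.cos (Real.pi / 4) :=
    Real.cos_pos_of_mem_Ioo ⟨by linarith [Real.pi_pos], by linarith [Real.pi_pos]⟩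
  refine tendsto_nhdsWithin_iff.2 ⟨?_, ?_⟩
  · have h1 : Tendsto (fun A : ℝ => 1 - ((2 / (A + 1) : ℝ) : ℂ)) atTop (𝓝 (1 - ((0 : ℝ) : ℂ))) :=
      tendsto_const_nhds.sub ((Complex.continuous_ofReal.tendsto 0).comp hlim)
    rw [Complex.ofReal_zero, sub_zero] at h1
    refine h1.congr' ?_
    filter_upwards [eventually_gt_atTop 0] with A hA
    rw [← e A hA, sub_sub_cancel]
  · filter_upwards [eventually_gt_atTop 0, hlim.eventually_lt_const (half_pos hcos)] with A hA hA2
    have hpos : 0 ≤ 2 / (A + 1) := by positivity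
    refine ⟨by simpa using invCayley_mem_ball (w := A) (by simpa using hA), ?_, ?_⟩
    · rw [map_one, one_mul, e A hA, Complex.arg_ofReal_of_nonneg hpos, abs_zero]
      positivity
    · rw [map_one, one_mul, e A hA, Complex.norm_real, Real.norm_of_nonneg hpos]
      exact hA2

end Cayley

/-! ### Positivity of `Re k'` for the Kœnigs function. -/

section Koenigs

open Metric Bornology

variable {φ : ℝ → ℂ → ℂ} {h : ℂ → ℂ}

theorem differentiableOn_comp_invCayley {f : ℂ → ℂ} (hf : DifferentiableOn ℂ f (ball 0 1)) :
    DifferentiableOn ℂ (fun w => f ((w - 1) / (w + 1))) {w | 0 < w.re} := by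
  refine hf.comp (f := fun w : ℂ => (w - 1) / (w + 1)) ?_ fun w hw => invCayley_mem_ball hw
  exact DifferentiableOn.div (by fun_prop) (by fun_prop) fun w hw => add_one_ne_zero_of_re_pos hw

/-- In half-plane coordinates the semigroup does not decrease the real part. -/
theorem re_le_re_semigroup (hφ : IsOneParameterSemigroup φ) (hτ : IsDenjoyWolffPoint φ 1)
    (hh : IsKoenigsFunction φ h) {t : ℝ} (ht : 0 < t) {w : ℂ} (hw : 0 < w.re) :
    w.re ≤ ((1 + φ t ((w - 1) / (w + 1))) / (1 - φ t ((w - 1) / (w + 1)))).re := by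
  have hid : ¬ EqOn (φ t) id (ball 0 1) := by
    intro hid
    have h0 : (0 : ℂ) ∈ ball (0 : ℂ) 1 := by simp
    have h1 := hh.abel t ht.le 0 h0
    rw [hid h0, id] at h1
    have h2 : (t : ℂ) = 0 := by linear_combination -h1
    exact ht.ne' (by exact_mod_cast h2)
  obtain ⟨d, hd, hlim⟩ : ∃ d : ℂ, ‖d‖ ≤ 1 ∧
      HasAngularLimit (fun z => (φ t z - 1) / (z - 1)) 1 d := by
    rcases hτ.2 t ht hid with h1 | h1
    · simp at h1
    · exact h1.2.2
  have hmaps : ∀ w : ℂ, 0 < w.re → φ t ((w - 1) / (w + 1)) ∈ ball (0 : ℂ) 1 := fun w hw =>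
    hφ.mapsTo t ht.le (invCayley_mem_ball hw)
  have hdiff := differentiableOn_comp_invCayley (hφ.holomorphic t ht.le)
  refine julia_halfPlane (q := fun w => (1 + φ t ((w - 1) / (w + 1))) /
    (1 - φ t ((w - 1) / (w + 1)))) ((hdiff.const_add 1).div (hdiff.const_sub 1)
      fun w hw => one_sub_ne_zero_of_mem_ball (hmaps w hw))
    (fun w hw => (cayley_re_pos (hmaps w hw)).le) hd ?_ hw
  have h1 := (hlim (Real.pi / 4) (by positivity) (by linarith [Real.pi_pos])).comp
    tendsto_invCayley_stolzAngle
  refine h1.congr' ?_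
  filter_upwards [eventually_gt_atTop 0] with A hA
  have hA' : 0 < (A : ℂ).re := by simpa using hA
  have h2 := one_sub_ne_zero_of_mem_ball (hmaps A hA')
  have h3 := add_one_ne_zero_of_re_pos hA'
  have e1 : ((A : ℂ) - 1) / (A + 1) - 1 = -2 / (A + 1) := by
    field_simp
    ring
  -- Together with `e1`, this identifies the quotient defining the angular derivative with `(1 + A)
  -- / (1 + q A)`, as Julia's lemma requires.
  have e2 : 1 + (1 + φ t (((A : ℂ) - 1) / (A + 1))) / (1 - φ t (((A : ℂ) - 1) / (A + 1))) =
      2 / (1 - φ t (((A : ℂ) - 1) / (A + 1))) := by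
    field_simp
    ring
  simp only [Function.comp_apply]
  rw [e1, e2]
  field_simp
  ring

/-- `k'(w)` is the limit of slopes along the orbit of `w`. Each slope is `t` over a displacement
with nonnegative real part, nonzero by the Abel equation. -/
theorem re_deriv_koenigs_comp_invCayley_nonneg (hφ : IsOneParameterSemigroup φ)
    (hτ : IsDenjoyWolffPoint φ 1) (hh : IsKoenigsFunction φ h) {w : ℂ} (hw : 0 < w.re) :
    0 ≤ (deriv (fun w => h ((w - 1) / (w + 1))) w).re := by
  set k : ℂ → ℂ := fun w => h ((w - 1) / (w + 1)) with hk
  have hd : HasDerivAt k (deriv k w) w :=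
    hasDerivAt_of_rightHalfPlane (differentiableOn_comp_invCayley hh.holomorphic) hw
  have hz := invCayley_mem_ball hw
  set z := (w - 1) / (w + 1) with hzdef
  have habel : ∀ t : ℝ, 0 < t → k ((1 + φ t z) / (1 - φ t z)) = k w + t := by
    intro t ht
    have h1 := one_sub_ne_zero_of_mem_ball (hφ.mapsTo t ht.le hz)
    simp only [hk]
    rw [invCayley_cayley h1, hh.abel t ht.le z hz]
  have hne : ∀ t : ℝ, 0 < t → (1 + φ t z) / (1 - φ t z) ≠ w := by
    intro t ht h0
    have h1 := habel t ht
    rw [h0] at h1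
    have h2 : (t : ℂ) = 0 := by linear_combination -h1
    exact ht.ne' (by exact_mod_cast h2)
  have hlim : Tendsto (fun t => (1 + φ t z) / (1 - φ t z)) (𝓝[>] 0) (𝓝[≠] w) := by
    refine tendsto_nhdsWithin_iff.2 ⟨?_, ?_⟩
    · have hz1 : z ≠ 1 := fun h0 => one_sub_ne_zero_of_mem_ball hz (by rw [h0, sub_self])
      have h1 := (continuousAt_cayley hz1).tendsto.comp (hφ.continuous z hz)
      rwa [hzdef, cayley_invCayley hw] at h1
    · filter_upwards [self_mem_nhdsWithin] with t ht using hne t ht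
  have h1 := (Complex.continuous_re.tendsto _).comp
    ((hasDerivAt_iff_tendsto_slope.1 hd).comp hlim)
  refine ge_of_tendsto h1 ?_
  filter_upwards [self_mem_nhdsWithin] with t ht
  have ht' : 0 < t := ht
  have h2 := re_le_re_semigroup hφ hτ hh ht' hw
  simp only [Function.comp_apply]
  rw [slope_def_field, habel t ht', add_sub_cancel_left, div_eq_mul_inv, Complex.re_ofReal_mul,
    Complex.inv_re, Complex.sub_re]
  exact mul_nonneg ht'.le (div_nonneg (sub_nonneg.2 h2) (Complex.normSq_nonneg _))

end Koenigs

/-! ### Return to the disk. -/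

theorem proposition3p4 (φ : ℝ → ℂ → ℂ) (h : ℂ → ℂ)
    (hφ : IsOneParameterSemigroup φ) (hτ : IsDenjoyWolffPoint φ 1)
    (hh : IsKoenigsFunction φ h) :
    (∀ σ : ℂ, ‖σ‖ = 1 →
      ∃ l : OnePoint ℂ, HasAngularLimit (fun z => (h z : OnePoint ℂ)) σ l) ∧
    (∀ σ : ℂ, ‖σ‖ = 1 → σ ≠ 1 →
      limsup (fun z => (((h z).re : ℝ) : EReal)) (𝓝[Metric.ball 0 1] σ) < ⊤) := by
  set k : ℂ → ℂ := fun w => h ((w - 1) / (w + 1)) with hk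
  have hdk : DifferentiableOn ℂ k {w | 0 < w.re} := differentiableOn_comp_invCayley hh.holomorphic
  have hp : ∀ w : ℂ, 0 < w.re → 0 ≤ (deriv k w).re := fun w hw =>
    re_deriv_koenigs_comp_invCayley_nonneg hφ hτ hh hw
  have hkh : ∀ z ∈ Metric.ball (0 : ℂ) 1, k ((1 + z) / (1 - z)) = h z := fun z hz => by
    simp only [hk]
    rw [invCayley_cayley (one_sub_ne_zero_of_mem_ball hz)]
  have hstolz : ∀ σ α, ∀ z ∈ stolzAngle σ α, z ∈ Metric.ball (0 : ℂ) 1 := fun σ α z hz => by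
    simpa using hz.1
  have hre0 : ∀ σ : ℂ, ‖σ‖ = 1 → ((1 + σ) / (1 - σ)).re = 0 := fun σ hσ => by
    rw [cayley_re, hσ]
    simp
  refine ⟨fun σ hσ => ?_, fun σ hσ hσ1 => ?_⟩
  · rcases eq_or_ne σ 1 with rfl | hσ1
    · have hne : deriv k 1 ≠ 0 := by
        intro h0
        have h1 := eq_add_mul_of_re_deriv_one_eq_zero hdk hp (by rw [h0, Complex.zero_re])
          (cayley_re_pos (hφ.mapsTo 1 zero_le_one (show (0 : ℂ) ∈ Metric.ball (0 : ℂ) 1 by simp)))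
        have h2 : k 1 = h 0 := by simp [hk]
        rw [h0, zero_mul, h2, hkh _ (hφ.mapsTo 1 zero_le_one (by simp)),
          hh.abel 1 zero_le_one 0 (by simp)] at h1
        simp at h1
      refine ⟨OnePoint.infty, fun α hα0 hα => ?_⟩
      obtain ⟨M, hM⟩ := tendsto_cayley_stolzAngle_one hα0 hα
      have h1 := (tendsto_cobounded_of_re_deriv_nonneg hdk hp hne M).comp hM
      rw [Metric.cobounded_eq_cocompact, ← coclosedCompact_eq_cocompact] at h1
      refine (OnePoint.tendsto_coe_infty.comp h1).congr' ?_
      filter_upwards [self_mem_nhdsWithin] with z hz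
      simp only [Function.comp_apply]
      rw [hkh z (hstolz _ _ z hz)]
    -- `w₀` is purely imaginary, so translating by it preserves the half-plane and moves the
    -- boundary point to 0.
    · set w₀ := (1 + σ) / (1 - σ) with hw₀
      have hre : ∀ w : ℂ, (w + w₀).re = w.re := fun w => by
        rw [Complex.add_re, hre0 σ hσ, add_zero]
      obtain ⟨l, hl⟩ := exists_tendsto_onePoint_of_re_deriv_nonneg
        (k := fun w => k (w + w₀))
        (hdk.comp (f := fun w => w + w₀) (by fun_prop) fun w hw => by
          rw [mem_ofPred_eq, hre]
          exact hw)
        (fun w hw => by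
          rw [deriv_comp_add_const]
          exact hp _ (by rwa [hre]))
      refine ⟨l, fun α hα0 hα => ?_⟩
      obtain ⟨M, hM⟩ := tendsto_cayley_stolzAngle hσ hσ1 hα0 hα
      refine ((hl M).comp hM).congr' ?_
      filter_upwards [self_mem_nhdsWithin] with z hz
      simp only [Function.comp_apply]
      rw [sub_add_cancel, hkh z (hstolz _ _ z hz)]
  · have hC : Tendsto (fun z : ℂ => (1 + z) / (1 - z)) (𝓝[Metric.ball 0 1] σ)
        (𝓝 ((1 + σ) / (1 - σ))) :=
      tendsto_nhdsWithin_of_tendsto_nhds (continuousAt_cayley hσ1)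
    set b := ((1 + σ) / (1 - σ)).im
    -- Near `σ`, monotonicity bounds `Re h z` by `Re k` at the point of the line `Re = 1` at the
    -- same height, where `k` is continuous.
    have him : Tendsto (fun z : ℂ => (k ((((1 + z) / (1 - z)).im : ℂ) * Complex.I + (1 : ℝ))).re)
        (𝓝[Metric.ball 0 1] σ) (𝓝 (k ((b : ℂ) * Complex.I + (1 : ℝ))).re) := by
      have h1 : Tendsto (fun z : ℂ => (((1 + z) / (1 - z)).im : ℂ) * Complex.I + (1 : ℝ))
          (𝓝[Metric.ball 0 1] σ) (𝓝 ((b : ℂ) * Complex.I + (1 : ℝ))) := by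
        have : Continuous fun w : ℂ => (w.im : ℂ) * Complex.I + (1 : ℝ) := by fun_prop
        exact (this.tendsto _).comp hC
      have h2 : ContinuousAt k ((b : ℂ) * Complex.I + (1 : ℝ)) :=
        (hasDerivAt_of_rightHalfPlane hdk (by simp)).continuousAt
      exact (Complex.continuous_re.tendsto _).comp (h2.tendsto.comp h1)
    have hrelim : Tendsto (fun z : ℂ => ((1 + z) / (1 - z)).re) (𝓝[Metric.ball 0 1] σ) (𝓝 0) := by
      rw [← hre0 σ hσ]
      exact (Complex.continuous_re.tendsto _).comp hC
    refine lt_of_le_of_lt (limsup_le_of_le (by isBoundedDefault) ?_)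
      (EReal.coe_lt_top ((k ((b : ℂ) * Complex.I + (1 : ℝ))).re + 1))
    filter_upwards [self_mem_nhdsWithin, him.eventually_lt_const (lt_add_one _),
      hrelim.eventually_lt_const one_pos] with z hz hz1 hz2
    have h1 := monotoneOn_re_horizontal hdk hp ((1 + z) / (1 - z)).im
      (cayley_re_pos hz) (mem_Ioi.2 one_pos) hz2.le
    have e1 : (((1 + z) / (1 - z)).im : ℂ) * Complex.I + (((1 + z) / (1 - z)).re : ℝ) =
        (1 + z) / (1 - z) := by
      rw [add_comm, Complex.re_add_im]
    simp only [e1, hkh z hz] at h1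
    exact EReal.coe_le_coe_iff.2 (h1.trans hz1.le)
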